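/- Let $\Omega$ be a set and let $\rho:\Omega\times\Omega\to[0,\infty)$ satisfy $\rho(x,y)=0\Leftrightarrow x=y$ and $\rho(x,y)=\rho(y,x)$. For $x\in\Omega$, $r>0$ put $B(x,r)=\{y\in\Omega:\rho(x,y)<r\}$; call $A\subset\Omega$ open if every $x\in A$ is the center of a ball contained in $A$, and bounded if it is contained in a ball. Let $\mu$ be a regular positive Borel measure on $\Omega$, and let $\Omega_1\subset\Omega_2\subset\cdots$ be bounded measurable sets with union $\Omega$. Assume that $(\Omega,\{\Omega_n\},\rho,\mu)$ is a \emph{locally homogeneous space}, that is: the balls are open; $\overline{B(x,r)}\subset\{y:\rho(x,y)\le r\}$ for all $x\in\Omega$, $r>0$; and for every $n$ the closure of $\Omega_n$ is compact and there are constants $\varepsilon_n>0$, $B_n\ge1$, $C_n>1$ such that \[ \{x\in\Omega:\rho(x,y)<2\varepsilon_n\text{ for some }y\in\Omega_n\}\subset\Omega_{n+1}, \] \[ \rho(x,y)\le B_n(\rho(x,z)+\rho(z,y))\quad\text{for all }x,y,z\in\Omega_n, \] \[ 0<\mu(B(x,2r))\le C_n\,\mu(B(x,r))<\infty\quad\text{for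 all }x\in\Omega_n,\ 0<r\le\varepsilon_n . \] A set $X$ with a symmetric function $\rho:X\times X\to[0,\infty)$ that vanishes exactly on the diagonal and a positive Borel measure $\mu$ is a \emph{space of homogeneous type} with constants $B\ge1$ and $C$ ($C$ is the doubling constant) if the $\rho$-balls are open in the topology they induce, and $\rho(x,y)\le B(\rho(x,z)+\rho(z,y))$ and $0<\mu(B(x,2r))\le C\mu(B(x,r))<\infty$ for all $x,y,z\in X$, $r>0$. A subset of $\Omega$ is a space of homogeneous type if it is one with respect to the restrictions of $\rho$ and $\mu$. Theorem. For every $n$ there exist $R_n>0$ and constants $B', C', c$, all depending only on $\varepsilon_j,B_j,C_j$ for $j=n,n+1,n+2,n+3$, such that for all $\overline{x}\in\Omega_n$ and $0<R\le R_n$ there is an open set $F\subset\Omega$ with the following properties: (i) $F$ is a space of homogeneous type with constants $B'$ and $C'$ (in particular its doubling constant does not depend on $\overline{x}$ or $R$); (ii) $B(\overline{x},R)\setminus E\subset F\subset\Omega_{n+2}$ for some set $E$ with $\mu(E)=0$; (iii) $B(\overline{x},R)\subset\overline{F}$; (iv) $\operatorname{diam}F=\sup_{x,y\in F}\rho(x,y)\le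 cR$; (v) $\mu(F)\le c\,\mu(B(\overline{x},R))$. -/

import Mathlib

open MeasureTheory

/-- The ball `B(x, r) = {y : ρ(x, y) < r}` of a function `ρ : X × X → ℝ`. -/
def qball {X : Type*} (ρ : X → X → ℝ) (x : X) (r : ℝ) : Set X :=
  {y | ρ x y < r}

/-- The diameter `sup {ρ(x, y) : x, y ∈ S}`, as an extended nonnegative number. -/
noncomputable def qdiam {X : Type*} (ρ : X → X → ℝ) (S : Set X) : ENNReal :=
  ⨆ x ∈ S, ⨆ y ∈ S, ENNReal.ofReal (ρ x y)

/-- The topology of `X` is the one induced by the `ρ`-balls: `A` is open if and only if each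
point of `A` is the center of a ball contained in `A`. -/
def IsBallTopology {X : Type*} [TopologicalSpace X] (ρ : X → X → ℝ) : Prop :=
  ∀ A : Set X, IsOpen A ↔ ∀ x ∈ A, ∃ r : ℝ, 0 < r ∧ qball ρ x r ⊆ A

/-- `(Ω, {Ω_n}, ρ, μ)` is a locally homogeneous space, with `ε n`, `B n`, `C n` as the constants
of `Ω_n`. Here `Ω` is the type `X` and `Ω_n` is the set `D n`. -/
structure IsLocallyHomogeneousSpace {X : Type*} [TopologicalSpace X] [MeasurableSpace X]
    (D : ℕ → Set X) (ρ : X → X → ℝ) (μ : Measure X) (ε B C : ℕ → ℝ) : Prop where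
  nonneg : ∀ x y, 0 ≤ ρ x y
  eq_zero_iff : ∀ x y, ρ x y = 0 ↔ x = y
  symm : ∀ x y, ρ x y = ρ y x
  topology : IsBallTopology ρ
  isOpen_ball : ∀ x r, 0 < r → IsOpen (qball ρ x r)
  closure_ball : ∀ x r, 0 < r → closure (qball ρ x r) ⊆ {y | ρ x y ≤ r}
  borel : BorelSpace X
  regular : μ.Regular
  mono : Monotone D
  bounded : ∀ n, ∃ (x : X) (r : ℝ), 0 < r ∧ D n ⊆ qball ρ x r
  measurableSet : ∀ n, MeasurableSet (D n)
  iUnion_eq : ⋃ n, D n = Set.univ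
  isCompact_closure : ∀ n, IsCompact (closure (D n))
  eps_pos : ∀ n, 0 < ε n
  nhd_subset : ∀ n, {x | ∃ y ∈ D n, ρ x y < 2 * ε n} ⊆ D (n + 1)
  one_le : ∀ n, 1 ≤ B n
  quasi_triangle : ∀ n, ∀ x ∈ D n, ∀ y ∈ D n, ∀ z ∈ D n, ρ x y ≤ B n * (ρ x z + ρ z y)
  one_lt : ∀ n, 1 < C n
  doubling : ∀ n, ∀ x ∈ D n, ∀ r, 0 < r → r ≤ ε n →
    0 < μ (qball ρ x (2 * r)) ∧
    μ (qball ρ x (2 * r)) ≤ ENNReal.ofReal (C n) * μ (qball ρ x r) ∧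
    μ (qball ρ x r) < ⊤

/-- `(X, ρ, μ)` is a space of homogeneous type, with constant `B` in the quasitriangle inequality
and doubling constant `C`. -/
structure IsSpaceOfHomogeneousType {X : Type*} [TopologicalSpace X] [MeasurableSpace X]
    (ρ : X → X → ℝ) (μ : Measure X) (B C : ℝ) : Prop where
  nonneg : ∀ x y, 0 ≤ ρ x y
  eq_zero_iff : ∀ x y, ρ x y = 0 ↔ x = y
  symm : ∀ x y, ρ x y = ρ y x
  one_le : 1 ≤ B
  quasi_triangle : ∀ x y z, ρ x y ≤ B * (ρ x z + ρ z y)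
  topology : IsBallTopology ρ
  isOpen_ball : ∀ x r, 0 < r → IsOpen (qball ρ x r)
  borel : BorelSpace X
  doubling : ∀ x r, 0 < r →
    0 < μ (qball ρ x (2 * r)) ∧
    μ (qball ρ x (2 * r)) ≤ ENNReal.ofReal C * μ (qball ρ x r) ∧
    μ (qball ρ x r) < ⊤

/-- A subset `S` of `X` is a space of homogeneous type with respect to the restrictions to `S` of
the function `ρ` and of the measure `μ` given on `X`. -/
def IsHomogeneousSubset {X : Type*} [TopologicalSpace X] [MeasurableSpace X]
    (ρ : X → X → ℝ) (μ : Measure X) (S : Set X) (B C : ℝ) : Prop :=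
  IsSpaceOfHomogeneousType (X := S) (fun x y => ρ x y) (μ.comap Subtype.val) B C

/-! A ball may fail to be doubling because `B(x, r) ∩ B(x₀, R)` can be too thin near the edge. The
remedy is to thicken `B(x₀, R)` by `δR`, `δ²R`, … and take the union `F`. With `2bδ ≤ 1` the
geometric decay beats the quasitriangle constant `b`, so `F` stays within `2bR` of `x₀`.

A point of `F` lies within about `δ^(m+1) R` of stage `m`, and each point of stage `m` carries a
ball of radius `δ^(m+1) R` inside `F`. Hence `F ∩ B(x, s)` contains a ball of radius `κs` for all `s
≤ R` (`exists_qball_subset_plumpHull`), and doubling of `F` follows from iterated doubling around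
the center of that ball. Since `F` contains the whole ball, the exceptional set is empty. -/

/-- The set of points at `ρ`-distance less than `t` from some point of `S`. -/
def qthickening {X : Type*} (ρ : X → X → ℝ) (t : ℝ) (S : Set X) : Set X :=
  {y | ∃ x ∈ S, ρ x y < t}

/-- Start with the ball `B(x₀, R)` and thicken successively by `δ R, δ² R, …`. -/
def plumpStage {X : Type*} (ρ : X → X → ℝ) (x₀ : X) (R δ : ℝ) : ℕ → Set X
  | 0 => qball ρ x₀ R
  | k + 1 => qthickening ρ (δ ^ (k + 1) * R) (plumpStage ρ x₀ R δ k)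

/-- The union of all stages of the successive thickening of the ball `B(x₀, R)`. -/
def plumpHull {X : Type*} (ρ : X → X → ℝ) (x₀ : X) (R δ : ℝ) : Set X :=
  ⋃ k, plumpStage ρ x₀ R δ k

/-! ### Geometry of the successive thickenings -/

section Plump

variable {X : Type*} {ρ : X → X → ℝ} {x₀ : X} {R δ b : ℝ}

theorem plumpStage_mono (h0 : ∀ x, ρ x x = 0) (hR : 0 < R) (hδ : 0 < δ) :
    Monotone (plumpStage ρ x₀ R δ) :=
  monotone_nat_of_le_succ fun k x hx => ⟨x, hx, by rw [h0]; positivity⟩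

theorem qball_subset_plumpStage_succ {k : ℕ} {x : X} (hx : x ∈ plumpStage ρ x₀ R δ k) :
    qball ρ x (δ ^ (k + 1) * R) ⊆ plumpStage ρ x₀ R δ (k + 1) :=
  fun _ hy => ⟨x, hx, hy⟩

theorem qball_subset_plumpHull {k : ℕ} {x : X} (hx : x ∈ plumpStage ρ x₀ R δ k) :
    qball ρ x (δ ^ (k + 1) * R) ⊆ plumpHull ρ x₀ R δ :=
  (qball_subset_plumpStage_succ hx).trans (Set.subset_iUnion _ (k + 1))

/-- Every point of a stage is close to every earlier stage. -/
theorem exists_mem_plumpStage_le (h0 : ∀ x, ρ x x = 0) (hR : 0 < R) (hδ : 0 < δ) (hb : 1 ≤ b)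
    (hbδ : 2 * b * δ ≤ 1) {T : Set X}
    (htri : ∀ x ∈ T, ∀ y ∈ T, ∀ z ∈ T, ρ x y ≤ b * (ρ x z + ρ z y))
    {k : ℕ} (hT : ∀ j ≤ k, plumpStage ρ x₀ R δ j ⊆ T) {x : X} (hx : x ∈ plumpStage ρ x₀ R δ k)
    {m : ℕ} (hm : m ≤ k) :
    ∃ y ∈ plumpStage ρ x₀ R δ m, ρ y x ≤ 2 * b * (δ ^ (m + 1) * R) := by
  -- Descending from `k` to `m` puts the accumulated distance to `x` in a single term, so each step
  -- costs one factor `b`, absorbed by `2bδ ≤ 1`; an ascending chain would accumulate powers of `b`.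
  induction hm using Nat.decreasingInduction with
  | self => exact ⟨x, hx, by rw [h0]; positivity⟩
  | of_succ m hm ih =>
    obtain ⟨y, hy, hyx⟩ := ih
    obtain ⟨z, hz, hzy⟩ := id hy
    refine ⟨z, hz, (htri z (hT m hm.le hz) x (hT k le_rfl hx) y (hT (m + 1) hm hy)).trans ?_⟩
    have hp : 0 < δ ^ (m + 1) * R := by positivity
    have h1 : 2 * b * (δ ^ (m + 1 + 1) * R) ≤ δ ^ (m + 1) * R := by
      calc 2 * b * (δ ^ (m + 1 + 1) * R) = (2 * b * δ) * (δ ^ (m + 1) * R) := by ring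
        _ ≤ 1 * (δ ^ (m + 1) * R) := by gcongr
        _ = _ := one_mul _
    calc b * (ρ z y + ρ y x) ≤ b * (δ ^ (m + 1) * R + δ ^ (m + 1) * R) := by
          gcongr
          exact hyx.trans h1
      _ = _ := by ring

/-- Compare with stage 0, then use one more quasitriangle inequality. Confinement to `T` is asked
only up to stage `k`, so that the bound can serve in the induction that proves confinement. -/
theorem exists_mem_qball_le (h0 : ∀ x, ρ x x = 0) (hR : 0 < R) (hδ : 0 < δ) (hb : 1 ≤ b)
    (hbδ : 2 * b * δ ≤ 1) {T : Set X} (hx₀ : x₀ ∈ T)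
    (htri : ∀ x ∈ T, ∀ y ∈ T, ∀ z ∈ T, ρ x y ≤ b * (ρ x z + ρ z y))
    {k : ℕ} (hT : ∀ j ≤ k, plumpStage ρ x₀ R δ j ⊆ T) {x : X}
    (hx : x ∈ plumpStage ρ x₀ R δ k) : ρ x₀ x ≤ 2 * b * R := by
  obtain ⟨y, hy, hyx⟩ :=
    exists_mem_plumpStage_le h0 hR hδ hb hbδ htri hT hx (Nat.zero_le k)
  have hy' : ρ x₀ y < R := hy
  have h1 : 2 * b * (δ ^ (0 + 1) * R) ≤ R := by
    calc 2 * b * (δ ^ (0 + 1) * R) = (2 * b * δ) * R := by ring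
      _ ≤ 1 * R := by gcongr
      _ = R := one_mul R
  calc ρ x₀ x ≤ b * (ρ x₀ y + ρ y x) :=
        htri _ hx₀ _ (hT k le_rfl hx) _ (hT 0 (Nat.zero_le k) hy)
    _ ≤ b * (R + R) := by
        gcongr
        exact hyx.trans h1
    _ = 2 * b * R := by ring

/-- The hull contains, near each of its points and at each scale up to `R`, a ball of comparable
radius. -/
theorem exists_qball_subset_plumpHull (h0 : ∀ x, ρ x x = 0) (hsymm : ∀ x y, ρ x y = ρ y x)
    (hR : 0 < R) (hδ : 0 < δ) (hb : 1 ≤ b) (hbδ : 2 * b * δ ≤ 1) {S T : Set X}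
    (htri : ∀ x ∈ T, ∀ y ∈ T, ∀ z ∈ T, ρ x y ≤ b * (ρ x z + ρ z y))
    (hST : S ⊆ T) (hS : plumpHull ρ x₀ R δ ⊆ S)
    {x : X} (hx : x ∈ plumpHull ρ x₀ R δ) {s : ℝ} (hs : 0 < s) (hsR : s ≤ R) :
    ∃ y ∈ plumpHull ρ x₀ R δ,
      qball ρ y (δ / (4 * b ^ 2) * s) ⊆ plumpHull ρ x₀ R δ ∩ qball ρ x s := by
  have hstage : ∀ j, plumpStage ρ x₀ R δ j ⊆ T := fun j =>
    (Set.subset_iUnion _ j).trans (hS.trans hST)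
  have hb0 : 0 < b := by linarith
  have hb2 : 1 ≤ b ^ 2 := one_le_pow₀ hb
  have hδ1 : δ < 1 := by nlinarith
  -- The scale `m` satisfies `δ^(m+1) R < s / (4b²) ≤ δ^m R`: the ball around `y` has radius at
  -- least `κs`, yet reaches at most `3b² δ^(m+1) R < s` from `x`.
  obtain ⟨m, hm1, hm2⟩ := exists_nat_pow_near_of_lt_one (x := s / (4 * b ^ 2 * R)) (by positivity)
    ((div_le_one (by positivity)).2 (by nlinarith)) hδ hδ1
  rw [lt_div_iff₀ (by positivity)] at hm1
  rw [div_le_iff₀ (by positivity)] at hm2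
  obtain ⟨k, hk⟩ := Set.mem_iUnion.1 hx
  -- The point may have entered before stage `m`, hence the maximum.
  have hk' := plumpStage_mono h0 hR hδ (le_max_left k m) hk
  obtain ⟨y, hy, hyx⟩ := exists_mem_plumpStage_le h0 hR hδ hb hbδ htri (fun j _ => hstage j) hk'
    (le_max_right k m)
  refine ⟨y, Set.mem_iUnion.2 ⟨m, hy⟩, ?_⟩
  have hle : δ / (4 * b ^ 2) * s ≤ δ ^ (m + 1) * R := by
    rw [div_mul_eq_mul_div, div_le_iff₀ (by positivity)]
    calc δ * s ≤ δ * (δ ^ m * (4 * b ^ 2 * R)) := by gcongr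
      _ = _ := by ring
  intro z hz
  have hz' : ρ y z < δ ^ (m + 1) * R := lt_of_lt_of_le hz hle
  have hzF : z ∈ plumpHull ρ x₀ R δ := qball_subset_plumpHull hy hz'
  refine ⟨hzF, ?_⟩
  have hp : 0 < δ ^ (m + 1) * R := by positivity
  have hxz := htri x (hST (hS hx)) z (hST (hS hzF)) y (hstage m hy)
  rw [hsymm x y] at hxz
  have hxz' : ρ x z ≤ b * (2 * b * (δ ^ (m + 1) * R) + b * (δ ^ (m + 1) * R)) := by
    refine hxz.trans ?_
    gcongr
    nlinarith
  change ρ x z < s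
  nlinarith [mul_pos (pow_pos hb0 2) hp]

end Plump

/-! ### Induced topology and iterated doubling -/

theorem isOpen_plumpHull {X : Type*} [TopologicalSpace X] {ρ : X → X → ℝ} {x₀ : X} {R δ : ℝ}
    (htop : IsBallTopology ρ) (hR : 0 < R) (hδ : 0 < δ) : IsOpen (plumpHull ρ x₀ R δ) := by
  refine (htop _).2 fun x hx => ?_
  obtain ⟨k, hk⟩ := Set.mem_iUnion.1 hx
  exact ⟨_, by positivity, qball_subset_plumpHull hk⟩

theorem IsBallTopology.restrict {X : Type*} [TopologicalSpace X] {ρ : X → X → ℝ} {F : Set X}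
    (htop : IsBallTopology ρ) (hF : IsOpen F) :
    IsBallTopology (X := F) (fun x y => ρ x y) := by
  intro A
  rw [hF.isOpenEmbedding_subtypeVal.isOpen_iff_image_isOpen, htop]
  constructor
  · intro h x hx
    obtain ⟨r, hr, hsub⟩ := h x ⟨x, hx, rfl⟩
    refine ⟨r, hr, fun y hy => ?_⟩
    obtain ⟨z, hz, hzy⟩ := hsub (show (y : X) ∈ qball ρ x r from hy)
    rwa [← Subtype.ext hzy]
  · rintro h _ ⟨x, hx, rfl⟩
    obtain ⟨r, hr, hsub⟩ := h x hx
    obtain ⟨r', hr', hsub'⟩ := (htop F).1 hF x x.2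
    refine ⟨min r r', lt_min hr hr', fun y hy => ?_⟩
    have hy' : ρ x y < min r r' := hy
    have hyF : y ∈ F := hsub' (show ρ x y < r' from hy'.trans_le (min_le_right _ _))
    exact ⟨⟨y, hyF⟩, hsub (show ρ x y < r from hy'.trans_le (min_le_left _ _)), rfl⟩

/-- Iterated doubling. -/
theorem measure_qball_two_pow_mul_le {X : Type*} [MeasurableSpace X] {ρ : X → X → ℝ}
    {μ : Measure X} {x : X} {ε C : ℝ}
    (hdoub : ∀ r, 0 < r → r ≤ ε → μ (qball ρ x (2 * r)) ≤ ENNReal.ofReal C * μ (qball ρ x r))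
    (N : ℕ) {r : ℝ} (hr : 0 < r) (hN : 2 ^ N * r ≤ ε) :
    μ (qball ρ x (2 ^ N * r)) ≤ ENNReal.ofReal C ^ N * μ (qball ρ x r) := by
  induction N with
  | zero => simp
  | succ N ih =>
    have h1 : (2 : ℝ) ^ (N + 1) * r = 2 * (2 ^ N * r) := by ring
    have hp : 0 < (2 : ℝ) ^ N * r := by positivity
    rw [h1] at hN ⊢
    calc μ (qball ρ x (2 * (2 ^ N * r))) ≤ ENNReal.ofReal C * μ (qball ρ x (2 ^ N * r)) :=
          hdoub _ hp (by linarith)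
      _ ≤ ENNReal.ofReal C * (ENNReal.ofReal C ^ N * μ (qball ρ x r)) := by
          gcongr
          exact ih (by linarith)
      _ = _ := by rw [pow_succ]; ring

theorem qball_subset_qball {X : Type*} {ρ : X → X → ℝ} {x : X} {r s : ℝ} (h : r ≤ s) :
    qball ρ x r ⊆ qball ρ x s :=
  fun _ hy => lt_of_lt_of_le hy h

/-! ### The hull inside a locally homogeneous space -/

namespace IsLocallyHomogeneousSpace

variable {X : Type*} [TopologicalSpace X] [MeasurableSpace X] {D : ℕ → Set X} {ρ : X → X → ℝ}
  {μ : Measure X} {ε B C : ℕ → ℝ} {n : ℕ} {x₀ : X} {R δ : ℝ}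

theorem self_eq_zero (h : IsLocallyHomogeneousSpace D ρ μ ε B C) (x : X) : ρ x x = 0 :=
  (h.eq_zero_iff x x).2 rfl

/-- A bootstrap: if stage `k` lies in `D (n + 1)`, the next one lies in `D (n + 2)`, where the
quasitriangle inequality holds; the resulting bound `2bR < 2ε n` on the distance to `x₀` brings it
back into `D (n + 1)`. -/
theorem plumpStage_subset (h : IsLocallyHomogeneousSpace D ρ μ ε B C) (hx₀ : x₀ ∈ D n)
    (hR : 0 < R) (hδ : 0 < δ) (hBδ : 2 * B (n + 2) * δ ≤ 1)
    (hR0 : B (n + 2) * R < ε n) (hR1 : R < 2 * ε (n + 1)) (k : ℕ) :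
    plumpStage ρ x₀ R δ k ⊆ D (n + 1) := by
  have hB := h.one_le (n + 2)
  have hδ1 : δ ≤ 1 := by nlinarith
  induction k using Nat.strong_induction_on with
  | _ k ih =>
    cases k with
    | zero =>
      intro x hx
      have hx' : ρ x₀ x < R := hx
      refine h.nhd_subset n ⟨x₀, hx₀, ?_⟩
      rw [h.symm]
      nlinarith
    | succ k =>
      have hT : ∀ j ≤ k + 1, plumpStage ρ x₀ R δ j ⊆ D (n + 2) := by
        intro j hj
        rcases Nat.lt_or_eq_of_le hj with hj | rfl
        · exact (ih j hj).trans (h.mono (by omega))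
        · rintro x ⟨y, hy, hyx⟩
          refine h.nhd_subset (n + 1) ⟨y, ih k (Nat.lt_succ_self k) hy, ?_⟩
          rw [h.symm]
          have : δ ^ (k + 1) * R ≤ 1 * R := by
            gcongr
            exact pow_le_one₀ hδ.le hδ1
          linarith
      intro x hx
      have := exists_mem_qball_le h.self_eq_zero hR hδ hB hBδ (h.mono (by omega) hx₀)
        (h.quasi_triangle (n + 2)) hT hx
      refine h.nhd_subset n ⟨x₀, hx₀, ?_⟩
      rw [h.symm]
      linarith

theorem measure_qball_pos (h : IsLocallyHomogeneousSpace D ρ μ ε B C) {x : X} (hx : x ∈ D n)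
    {r : ℝ} (hr : 0 < r) (hrε : r ≤ ε n) : 0 < μ (qball ρ x r) := by
  have := (h.doubling n x hx (r / 2) (by positivity) (by linarith)).1
  rwa [mul_div_cancel₀ r two_ne_zero] at this

theorem isHomogeneousSubset_plumpHull (h : IsLocallyHomogeneousSpace D ρ μ ε B C)
    (hR : 0 < R) (hδ : 0 < δ) (hBδ : 2 * B (n + 2) * δ ≤ 1) {N : ℕ}
    (hN : 5 * B (n + 2) ^ 2 ≤ 2 ^ N * (δ / (4 * B (n + 2) ^ 2)))
    (hRN : 2 ^ N * (δ / (4 * B (n + 2) ^ 2) * R) ≤ ε (n + 1))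
    (hsub : plumpHull ρ x₀ R δ ⊆ D (n + 1))
    (hdist : ∀ x ∈ plumpHull ρ x₀ R δ, ∀ y ∈ plumpHull ρ x₀ R δ, ρ x y ≤ 4 * B (n + 2) ^ 2 * R) :
    IsHomogeneousSubset ρ μ (plumpHull ρ x₀ R δ) (B (n + 2)) (C (n + 1) ^ N) := by
  have hB := h.one_le (n + 2)
  have hB2 : 1 ≤ B (n + 2) ^ 2 := one_le_pow₀ hB
  have hD : D (n + 1) ⊆ D (n + 2) := h.mono (by omega)
  have hopen := isOpen_plumpHull (x₀ := x₀) h.topology hR hδ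
  have hborel := h.borel
  have hmeas := hopen.measurableSet
  have hcomap (x : plumpHull ρ x₀ R δ) (r : ℝ) :
      μ.comap Subtype.val (qball (fun x y : plumpHull ρ x₀ R δ => ρ x y) x r) =
        μ (plumpHull ρ x₀ R δ ∩ qball ρ x r) := by
    rw [comap_subtype_coe_apply hmeas]
    congr 1
    ext z
    simp [qball, and_comm]
  set κ := δ / (4 * B (n + 2) ^ 2) with hκ
  have hκ0 : 0 < κ := by positivity
  refine ⟨fun x y => h.nonneg x y, fun x y => (h.eq_zero_iff x y).trans Subtype.ext_iff.symm,
    fun x y => h.symm x y, hB,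
    fun x y z => h.quasi_triangle (n + 2) x (hD (hsub x.2)) y (hD (hsub y.2)) z (hD (hsub z.2)),
    h.topology.restrict hopen, fun x r hr => ?_, inferInstance, fun x r hr => ?_⟩
  · exact (h.isOpen_ball x r hr).preimage continuous_subtype_val
  · simp only [hcomap]
    -- Interior balls are available only up to scale `R`; beyond it the diameter bound on the hull
    -- replaces the radius `2r`.
    have hs : 0 < min r R := lt_min hr hR
    obtain ⟨y, hy, hyball⟩ := exists_qball_subset_plumpHull h.self_eq_zero h.symm hR hδ hB hBδ
      (h.quasi_triangle (n + 2)) hD hsub x.2 hs (min_le_right r R)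
    rw [← hκ] at hyball
    have hsN : 2 ^ N * (κ * min r R) ≤ ε (n + 1) := by
      refine le_trans ?_ hRN
      gcongr
      exact min_le_right r R
    have hsmall : κ * min r R ≤ ε (n + 1) := by
      refine le_trans ?_ hsN
      exact le_mul_of_one_le_left (by positivity) (one_le_pow₀ one_le_two)
    have hinner : μ (qball ρ y (κ * min r R)) ≤ μ (plumpHull ρ x₀ R δ ∩ qball ρ x r) :=
      measure_mono (hyball.trans
        (Set.inter_subset_inter_right _ (qball_subset_qball (min_le_left r R))))
    have hxy : ρ y x < min r R := by
      rw [h.symm]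
      exact (hyball (show ρ y y < _ by rw [h.self_eq_zero]; positivity)).2
    have houter : plumpHull ρ x₀ R δ ∩ qball ρ x (2 * r) ⊆
        qball ρ y (2 ^ N * (κ * min r R)) := by
      rintro z ⟨hz, hxz⟩
      have hxz' : ρ x z < 2 * r := hxz
      change ρ y z < _
      -- The factor 5 covers both cases strictly: `3b²r` when `r ≤ R`, and the diameter `4b²R`
      -- otherwise.
      have h5 : 5 * B (n + 2) ^ 2 * min r R ≤ 2 ^ N * (κ * min r R) := by
        rw [← mul_assoc]
        gcongr
      refine lt_of_lt_of_le ?_ h5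
      rcases le_total r R with hrR | hrR
      · rw [min_eq_left hrR] at hxy ⊢
        have := h.quasi_triangle (n + 2) y (hD (hsub hy)) z (hD (hsub hz)) x (hD (hsub x.2))
        have h3 : B (n + 2) * (ρ y x + ρ x z) ≤ B (n + 2) * (3 * r) := by
          gcongr
          linarith
        have h4 : B (n + 2) * (3 * r) ≤ 3 * (B (n + 2) ^ 2 * r) := by
          nlinarith [mul_nonneg (mul_nonneg (by linarith : 0 ≤ B (n + 2)) hr.le)
            (sub_nonneg.2 hB)]
        have : 0 < B (n + 2) ^ 2 * r := by positivity
        linarith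
      · rw [min_eq_right hrR]
        have := hdist y hy z hz
        have : 0 < B (n + 2) ^ 2 * R := by positivity
        linarith
    have hfull : plumpHull ρ x₀ R δ ⊆ qball ρ x (2 ^ N * (κ * R)) := by
      intro z hz
      have := hdist x x.2 z hz
      change ρ x z < _
      have : 5 * B (n + 2) ^ 2 * R ≤ 2 ^ N * (κ * R) := by
        rw [← mul_assoc]
        gcongr
      have : 0 < B (n + 2) ^ 2 * R := by positivity
      linarith
    refine ⟨?_, ?_, ?_⟩
    · refine (h.measure_qball_pos (hsub hy) (by positivity) hsmall).trans_le (hinner.trans ?_)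
      exact measure_mono (Set.inter_subset_inter_right _ (qball_subset_qball (by linarith)))
    · rw [ENNReal.ofReal_pow (by linarith [h.one_lt (n + 1)])]
      calc μ (plumpHull ρ x₀ R δ ∩ qball ρ x (2 * r))
          ≤ μ (qball ρ y (2 ^ N * (κ * min r R))) := measure_mono houter
        _ ≤ ENNReal.ofReal (C (n + 1)) ^ N * μ (qball ρ y (κ * min r R)) :=
            measure_qball_two_pow_mul_le
              (fun t ht htε => (h.doubling (n + 1) y (hsub hy) t ht htε).2.1) N
              (by positivity) hsN
        _ ≤ _ := by gcongr
    · exact (measure_mono (Set.inter_subset_left.trans hfull)).trans_lt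
        (h.doubling (n + 1) x (hsub x.2) _ (by positivity) hRN).2.2

end IsLocallyHomogeneousSpace

/-! ### Choice of the constants -/

theorem mainTheorem8 (e b d : Fin 4 → ℝ) :
    ∃ R₀ : ℝ, 0 < R₀ ∧ ∃ B' C' c₁ c₂ : ℝ,
      ∀ (X : Type*) [TopologicalSpace X] [MeasurableSpace X]
        (D : ℕ → Set X) (ρ : X → X → ℝ) (μ : Measure X) (ε B C : ℕ → ℝ),
        IsLocallyHomogeneousSpace D ρ μ ε B C →
        ∀ n : ℕ, (∀ i : Fin 4, ε (n + i) = e i ∧ B (n + i) = b i ∧ C (n + i) = d i) →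
        ∀ x₀ ∈ D n, ∀ R : ℝ, 0 < R → R ≤ R₀ →
        ∃ F : Set X, IsOpen F ∧
          IsHomogeneousSubset ρ μ F B' C' ∧
          (∃ E : Set X, μ E = 0 ∧ qball ρ x₀ R \ E ⊆ F) ∧ F ⊆ D (n + 2) ∧
          qball ρ x₀ R ⊆ closure F ∧
          qdiam ρ F ≤ ENNReal.ofReal (c₁ * R) ∧
          μ F ≤ ENNReal.ofReal c₂ * μ (qball ρ x₀ R) := by
  -- The constants are fixed before the space; if they violate these signs, no space has them and
  -- the claim is vacuous.
  by_cases hpos : 0 < e 0 ∧ 0 < e 1 ∧ 1 ≤ b 2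
  swap
  · refine ⟨1, one_pos, 0, 0, 0, 0, ?_⟩
    intro X _ _ D ρ μ ε B C h n hc
    refine absurd ⟨?_, ?_, ?_⟩ hpos
    · rw [← (hc 0).1]; exact h.eps_pos _
    · rw [← (hc 1).1]; exact h.eps_pos _
    · rw [← (hc 2).2.1]; exact h.one_le _
  obtain ⟨he0, he1, hb⟩ := hpos
  have hb0 : 0 < b 2 := by linarith
  set δ : ℝ := 1 / (2 * b 2) with hδ
  have hδ0 : 0 < δ := by positivity
  have hbδ : 2 * b 2 * δ ≤ 1 := by rw [hδ, mul_one_div_cancel (by positivity)]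
  have hb2 : 1 ≤ b 2 ^ 2 := one_le_pow₀ hb
  set κ : ℝ := δ / (4 * b 2 ^ 2) with hκ
  have hκ0 : 0 < κ := by positivity
  have hκ1 : κ ≤ 1 := by
    rw [hκ, div_le_one (by positivity)]
    nlinarith
  obtain ⟨N, hN⟩ := pow_unbounded_of_one_lt (5 * b 2 ^ 2 / κ) (one_lt_two (α := ℝ))
  rw [div_lt_iff₀ hκ0] at hN
  -- The first bound on `R` confines the hull to `D (n + 1)`; the second keeps the radius `2^N κR`
  -- within the range of doubling there.
  refine ⟨min (e 0 / (2 * b 2)) (e 1 / (2 ^ N * κ)), by positivity, b 2, d 1 ^ N,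
    4 * b 2 ^ 2, d 1 ^ N, ?_⟩
  intro X _ _ D ρ μ ε B C h n hc x₀ hx₀ R hR hRR
  have hε0 : ε n = e 0 := (hc 0).1
  have hε1 : ε (n + 1) = e 1 := (hc 1).1
  have hB : B (n + 2) = b 2 := (hc 2).2.1
  have hC : C (n + 1) = d 1 := (hc 1).2.2
  have hR0 : R ≤ e 0 / (2 * b 2) := hRR.trans (min_le_left _ _)
  have hR1 : R ≤ e 1 / (2 ^ N * κ) := hRR.trans (min_le_right _ _)
  rw [le_div_iff₀ (by positivity)] at hR0 hR1
  have hRN : 2 ^ N * (κ * R) ≤ e 1 := by linarith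
  have h5 : 5 * b 2 ^ 2 * R ≤ 2 ^ N * (κ * R) := by
    rw [← mul_assoc]
    gcongr
  have hbR : 0 < b 2 * R := by positivity
  have hbR2 : b 2 * R ≤ b 2 ^ 2 * R := by
    gcongr
    exact le_self_pow₀ hb two_ne_zero
  have hRb2 : R ≤ b 2 ^ 2 * R := le_mul_of_one_le_left hR.le hb2
  have hstage := h.plumpStage_subset hx₀ hR hδ0 (hB ▸ hbδ) (by rw [hB, hε0]; linarith)
    (by rw [hε1]; linarith)
  have hD : D (n + 1) ⊆ D (n + 2) := h.mono (by omega)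
  have hx₀' : x₀ ∈ D (n + 1) := h.mono (by omega) hx₀
  have hsub : plumpHull ρ x₀ R δ ⊆ D (n + 1) := Set.iUnion_subset hstage
  have htri := h.quasi_triangle (n + 2)
  rw [hB] at htri
  have hcenter : ∀ x ∈ plumpHull ρ x₀ R δ, ρ x₀ x ≤ 2 * b 2 * R := by
    intro x hx
    obtain ⟨k, hk⟩ := Set.mem_iUnion.1 hx
    exact exists_mem_qball_le h.self_eq_zero hR hδ0 hb hbδ (hD hx₀') htri
      (fun j _ => (hstage j).trans hD) hk
  have hdist : ∀ x ∈ plumpHull ρ x₀ R δ, ∀ y ∈ plumpHull ρ x₀ R δ,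
      ρ x y ≤ 4 * b 2 ^ 2 * R := by
    intro x hx y hy
    calc ρ x y ≤ b 2 * (ρ x x₀ + ρ x₀ y) :=
          htri x (hD (hsub hx)) y (hD (hsub hy)) x₀ (hD hx₀')
      _ ≤ b 2 * (2 * b 2 * R + 2 * b 2 * R) := by
          rw [h.symm x x₀]
          gcongr
          exacts [hcenter x hx, hcenter y hy]
      _ = _ := by ring
  have hball : qball ρ x₀ R ⊆ plumpHull ρ x₀ R δ :=
    Set.subset_iUnion (plumpStage ρ x₀ R δ) 0
  refine ⟨plumpHull ρ x₀ R δ, isOpen_plumpHull h.topology hR hδ0, ?_,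
    ⟨∅, measure_empty, Set.sdiff_subset.trans hball⟩, hsub.trans hD, hball.trans subset_closure,
    ?_, ?_⟩
  · rw [← hB, ← hC]
    refine h.isHomogeneousSubset_plumpHull hR hδ0 ?_ ?_ ?_ hsub ?_ <;> simp only [hB, hε1]
    exacts [hbδ, hN.le, hRN, hdist]
  · exact iSup₂_le fun x hx => iSup₂_le fun y hy => ENNReal.ofReal_le_ofReal (hdist x hx y hy)
  · rw [ENNReal.ofReal_pow (by linarith [h.one_lt (n + 1)])]
    calc μ (plumpHull ρ x₀ R δ) ≤ μ (qball ρ x₀ (2 ^ N * (κ * R))) := by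
          refine measure_mono fun x hx => ?_
          change ρ x₀ x < _
          linarith [hcenter x hx]
      _ ≤ ENNReal.ofReal (d 1) ^ N * μ (qball ρ x₀ (κ * R)) :=
          measure_qball_two_pow_mul_le (ε := e 1) (fun t ht htε => by
            rw [← hC]
            exact (h.doubling (n + 1) x₀ hx₀' t ht (hε1 ▸ htε)).2.1) N (by positivity) hRN
      _ ≤ _ := by
          gcongr
          exact qball_subset_qball (mul_le_of_le_one_left hR.le hκ1)
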